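/- Let $k$ be a field, and let $A$, $B$ be associative unital finite-dimensional $k$-algebras. Modules are finite-dimensional left modules, $J_A$ denotes the Jacobson radical of $A$, and $A^*=\operatorname{Hom}_k(A_A,k)$ is the dual of the right regular module, with left action $(a\varphi)(x)=\varphi(xa)$. For an $A$-module $Z$, let $\operatorname{add}(Z)$ be the class of all $A$-modules isomorphic to a direct summand of a finite direct sum of copies of $Z$; call $Z$ a generator-cogenerator of $A$ if $A\oplus A^*\in\operatorname{add}(Z)$, and put $$\operatorname{repdim}(A)=\min\{\operatorname{gldim}(\operatorname{End}_A(Z)) : Z \text{ a generator-cogenerator of } A\},$$ where in $\operatorname{End}_A(Z)$ maps are composed as if written on the right, and $\operatorname{gldim}(E)$ is the supremum of the projective dimensions of the finite-dimensional left $E$-modules. $B$ is representation-finite if it has only finitely many isomorphism classes of indecomposable modules. **Theorem 1.1.** Let $f\colon A\to B$ be a radical embedding, that is, an injective (unital) $k$-algebra homomorphism with $f(J_A)=J_B$. If $B$ is representation-finite, then $\operatorname{repdim}(A)\le 3$. More precisely, if $N$ is the direct sum of a complete set of representatives of the isomorphism classes of indecomposable $B$-modules, regarded as an $A$-module through $f$,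 then $A\oplus A^*\oplus N$ is a generator-cogenerator of $A$ and $\operatorname{gldim}(\operatorname{End}_A(A\oplus A^*\oplus N))\le 3$. -/

import Mathlib

universe u

namespace RadEmb

open CategoryTheory

section Modules

/-- A nonzero module is indecomposable if it is not the direct sum of two nonzero submodules. -/
def IsIndecomposable (R M : Type u) [Ring R] [AddCommGroup M] [Module R M] : Prop :=
  Nontrivial M ∧ ∀ P Q : Submodule R M, IsCompl P Q → P = ⊥ ∨ Q = ⊥

/-- `X` lies in `add(Z)`: it is isomorphic to a direct summand of a finite direct sum of
copies of `Z`. -/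
def InAdd (R X Z : Type u) [Ring R] [AddCommGroup X] [Module R X]
    [AddCommGroup Z] [Module R Z] : Prop :=
  ∃ (n : ℕ) (P Q : Submodule R (Fin n → Z)), IsCompl P Q ∧ Nonempty (X ≃ₗ[R] P)

/-- The (left) global dimension, computed in the category of finitely generated left modules:
the supremum of the projective dimensions of the finitely generated left `R`-modules. If `R` is
a finite-dimensional algebra, these are exactly the finite-dimensional left `R`-modules. -/
noncomputable def gldim (R : Type u) [Ring R] : WithBot ℕ∞ :=
  ⨆ (M : ModuleCat.{u} R) (_ : Module.Finite R M), projectiveDimension M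

/-- The endomorphism ring of a left module, with the multiplication in which `x * y` is "first
`x`, then `y`" (maps are composed as if they were written on the right). -/
abbrev EndRing (R Z : Type u) [Ring R] [AddCommGroup Z] [Module R Z] : Type u :=
  (Module.End R Z)ᵐᵒᵖ

/-- `M 0, …, M (n - 1)` is a complete set of representatives of the isomorphism classes of
indecomposable finitely generated left `R`-modules (for a finite-dimensional algebra `R`:
of indecomposable finite-dimensional ones), without repetitions. -/
structure IsCompleteSystem (R : Type u) [Ring R] {n : ℕ} (M : Fin n → ModuleCat.{u} R) :
    Prop where
  finite : ∀ i, Module.Finite R (M i)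
  indecomposable : ∀ i, IsIndecomposable R (M i)
  eq_of_iso : ∀ i j, Nonempty (M i ≃ₗ[R] M j) → i = j
  exists_iso : ∀ X : ModuleCat.{u} R, Module.Finite R X → IsIndecomposable R X →
    ∃ i, Nonempty (X ≃ₗ[R] M i)

/-- There are only finitely many isomorphism classes of indecomposable finitely generated
modules. -/
def IsRepresentationFinite (R : Type u) [Ring R] : Prop :=
  ∃ (n : ℕ) (M : Fin n → ModuleCat.{u} R), IsCompleteSystem R M

end Modules

section DualModule

variable (k A : Type u) [Field k] [Ring A] [Algebra k A]

/-- The left `A`-module `A^* = Hom_k(A, k)`, the dual of the right regular module. It is a type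
synonym of the space of linear forms on `A`, so that its `A`-action cannot clash with others. -/
def DualModule : Type u := Module.Dual k A

noncomputable instance : AddCommGroup (DualModule k A) :=
  inferInstanceAs (AddCommGroup (Module.Dual k A))

/-- The action is `(a • φ) x = φ (x * a)`. -/
noncomputable instance : Module A (DualModule k A) where
  smul a φ := LinearMap.comp (M₃ := k) (σ₁₃ := RingHom.id k) φ (LinearMap.mulRight k a)
  one_smul φ := LinearMap.ext fun x => congrArg (show A →ₗ[k] k from φ) (mul_one x)
  mul_smul a b φ := LinearMap.ext fun x =>
    congrArg (show A →ₗ[k] k from φ) (mul_assoc x a b).symm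
  smul_zero _ := rfl
  smul_add _ _ _ := rfl
  add_smul a b φ := LinearMap.ext fun x =>
    (congrArg (show A →ₗ[k] k from φ) (mul_add x a b)).trans
      (map_add (show A →ₗ[k] k from φ) _ _)
  zero_smul φ := LinearMap.ext fun x =>
    (congrArg (show A →ₗ[k] k from φ) (mul_zero x)).trans (map_zero (show A →ₗ[k] k from φ))

theorem DualModule.smul_apply (a : A) (φ : DualModule k A) (x : A) :
    (show A →ₗ[k] k from a • φ) x = (show A →ₗ[k] k from φ) (x * a) := rfl

/-- A generator-cogenerator of `A`: a finitely generated left `A`-module `Z` (over a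
finite-dimensional algebra: a finite-dimensional one) with `A ⊕ A^* ∈ add(Z)`. -/
def IsGeneratorCogenerator (Z : Type u) [AddCommGroup Z] [Module A Z] : Prop :=
  Module.Finite A Z ∧ InAdd A (A × DualModule k A) Z

/-- The representation dimension of `A`. The order on `WithBot ℕ∞` is a well-order, hence the
infimum of this nonempty set is a minimum. -/
noncomputable def repdim : WithBot ℕ∞ :=
  sInf {d | ∃ Z : ModuleCat.{u} A, IsGeneratorCogenerator k A Z ∧ d = gldim (EndRing A Z)}

end DualModule

section RadicalEmbedding

variable {k A B : Type u} [Field k] [Ring A] [Algebra k A] [Ring B] [Algebra k B]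

/-- A radical embedding: an injective algebra homomorphism that maps the Jacobson radical of `A`
onto the Jacobson radical of `B`. -/
def IsRadicalEmbedding (f : A →ₐ[k] B) : Prop :=
  Function.Injective f ∧ f '' (Ring.jacobson A : Set A) = (Ring.jacobson B : Set B)

/-- A `B`-module regarded as an `A`-module through `f`. -/
noncomputable abbrev restrict (f : A →ₐ[k] B) (N : ModuleCat.{u} B) : ModuleCat.{u} A :=
  (ModuleCat.restrictScalars (f : A →+* B)).obj N

/-- The `A`-module `A ⊕ A^* ⊕ N`, where `N` is the direct sum of the `B`-modules
`M 0, …, M (n - 1)`, regarded as an `A`-module through `f`. -/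
abbrev Witness (f : A →ₐ[k] B) {n : ℕ} (M : Fin n → ModuleCat.{u} B) : Type u :=
  A × DualModule k A × restrict f (ModuleCat.of B (∀ i, M i))

end RadicalEmbedding

end RadEmb

/-! Write Z = A ⊕ A^* ⊕ N and J for the radical. By `gldim_endRing_le_three` it is enough that each
finitely generated A-module X has an approximation p : M → X, with M and ker p in add(Z), through
which all maps Z → X factor.

Summands in add(Z) may be split off X (`HasApproximation.of_forall_summand`). Then every map A^* → X
kills the socle of A^*, since otherwise X and A^* would share a nonzero summand
(`exists_summand_of_dualModule`). Let ε : Hom_A(B, X) → X be evaluation at 1. Maps from B-modules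
factor through ε by adjunction, and so do maps from A^* that kill the socle
(`exists_lift_of_dualModule`).

Only maps from A remain. As J_A ≅ J_B is itself a B-module, J_A X lies in the image of ε, so coker ε
is annihilated by J_A. With P → coker ε a projective cover, p : P ⊕ Hom_A(B, X) → X is the
approximation: its kernel is ker ε ⊕ J_A P. Here ker ε is annihilated by J_A and J_A P lies in
add(J_A), so both are in add(N). -/

namespace RadEmb

open CategoryTheory

/-! ### The class add(Z), handled through retracts of powers of Z -/

section InAdd

variable {R X Y Z W : Type u} [Ring R] [AddCommGroup X] [Module R X] [AddCommGroup Y] [Module R Y]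
  [AddCommGroup Z] [Module R Z] [AddCommGroup W] [Module R W]

theorem inAdd_of_retract_pi {n : ℕ} (i : X →ₗ[R] (Fin n → Z)) (r : (Fin n → Z) →ₗ[R] X)
    (h : ∀ x, r (i x) = x) : InAdd R X Z := by
  refine ⟨n, LinearMap.range i, LinearMap.ker (i.rangeRestrict ∘ₗ r),
    LinearMap.isCompl_of_proj (f := i.rangeRestrict ∘ₗ r) ?_,
    ⟨LinearEquiv.ofInjective i (Function.LeftInverse.injective h)⟩⟩
  rintro ⟨_, x, rfl⟩
  ext1
  simp [h]

theorem InAdd.exists_retract_pi (h : InAdd R X Z) :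
    ∃ (n : ℕ) (i : X →ₗ[R] (Fin n → Z)) (r : (Fin n → Z) →ₗ[R] X), ∀ x, r (i x) = x := by
  obtain ⟨n, P, Q, hPQ, ⟨e⟩⟩ := h
  refine ⟨n, P.subtype ∘ₗ e.toLinearMap,
    e.symm.toLinearMap ∘ₗ P.projectionOnto Q hPQ, fun x => ?_⟩
  simp

theorem InAdd.of_retract (h : InAdd R Y Z) (i : X →ₗ[R] Y) (r : Y →ₗ[R] X)
    (hri : ∀ x, r (i x) = x) : InAdd R X Z := by
  obtain ⟨n, i', r', h'⟩ := h.exists_retract_pi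
  exact inAdd_of_retract_pi (i' ∘ₗ i) (r ∘ₗ r') fun x => by simp [h', hri]

theorem InAdd.of_equiv (h : InAdd R Y Z) (e : X ≃ₗ[R] Y) : InAdd R X Z :=
  h.of_retract e.toLinearMap e.symm.toLinearMap fun x => by simp

theorem InAdd.of_isCompl {P Q : Submodule R Y} (h : InAdd R Y Z) (hPQ : IsCompl P Q) :
    InAdd R P Z :=
  h.of_retract P.subtype (P.projectionOnto Q hPQ) fun x => by simp

variable (R Z) in
theorem InAdd.refl : InAdd R Z Z :=
  inAdd_of_retract_pi (n := 1) (LinearMap.pi fun _ => LinearMap.id) (LinearMap.proj 0)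
    fun _ => rfl

theorem InAdd.pi {n : ℕ} {X : Fin n → Type u} [∀ j, AddCommGroup (X j)] [∀ j, Module R (X j)]
    (h : ∀ j, InAdd R (X j) Z) : InAdd R (∀ j, X j) Z := by
  choose m i r hri using fun j => (h j).exists_retract_pi
  let e : (Σ j, Fin (m j)) ≃ Fin (Fintype.card (Σ j, Fin (m j))) := Fintype.equivFin _
  refine inAdd_of_retract_pi
    (LinearMap.pi fun t =>
      LinearMap.proj (e.symm t).2 ∘ₗ i (e.symm t).1 ∘ₗ LinearMap.proj (e.symm t).1)
    (LinearMap.pi fun j => r j ∘ₗ LinearMap.pi fun a => LinearMap.proj (e ⟨j, a⟩)) fun x => ?_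
  ext j
  rw [← hri j (x j)]
  simp only [LinearMap.pi_apply, LinearMap.comp_apply]
  congr 1
  ext a
  have (t : Σ j, Fin (m j)) (ht : t = ⟨j, a⟩) : i t.1 (x t.1) t.2 = i j (x j) a := by
    subst ht
    rfl
  simpa [hri] using this _ (e.symm_apply_apply ⟨j, a⟩)

theorem InAdd.prod (hX : InAdd R X Z) (hY : InAdd R Y Z) : InAdd R (X × Y) Z := by
  obtain ⟨m, i, r, h⟩ := hX.exists_retract_pi
  obtain ⟨m', i', r', h'⟩ := hY.exists_retract_pi
  have : InAdd R ((Fin m → Z) × (Fin m' → Z)) Z :=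
    inAdd_of_retract_pi
      (LinearMap.pi fun t : Fin (m + m') => Fin.addCases
        (fun a => LinearMap.proj a ∘ₗ LinearMap.fst R (Fin m → Z) (Fin m' → Z))
        (fun a => LinearMap.proj a ∘ₗ LinearMap.snd R (Fin m → Z) (Fin m' → Z)) t)
      (LinearMap.prod (LinearMap.pi fun a => LinearMap.proj (Fin.castAdd m' a))
        (LinearMap.pi fun a => LinearMap.proj (Fin.natAdd m a)))
      fun x => by ext a <;> simp
  exact this.of_retract (i.prodMap i') (r.prodMap r') fun x => by simp [h, h']

theorem InAdd.trans (hX : InAdd R X Y) (hY : InAdd R Y Z) : InAdd R X Z := by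
  obtain ⟨m, i, r, h⟩ := hX.exists_retract_pi
  exact (InAdd.pi fun _ => hY).of_retract i r h

theorem InAdd.of_subsingleton [Subsingleton X] : InAdd R X Z :=
  inAdd_of_retract_pi (n := 0) 0 0 fun _ => Subsingleton.elim _ _

/-- Factorization through p need only be tested on Z: it passes to powers and then to retracts. -/
theorem InAdd.exists_lift (h : InAdd R W Z) (p : Y →ₗ[R] X)
    (hp : ∀ g : Z →ₗ[R] X, ∃ g' : Z →ₗ[R] Y, p ∘ₗ g' = g) (g : W →ₗ[R] X) :
    ∃ g' : W →ₗ[R] Y, p ∘ₗ g' = g := by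
  obtain ⟨m, i, r, hri⟩ := h.exists_retract_pi
  choose q hq using fun j => hp (g ∘ₗ r ∘ₗ LinearMap.single R (fun _ => Z) j)
  refine ⟨LinearMap.lsum R (fun _ => Z) ℕ q ∘ₗ i, ?_⟩
  have : p ∘ₗ LinearMap.lsum R (fun _ => Z) ℕ q = g ∘ₗ r := by
    refine LinearMap.pi_ext' fun j => ?_
    ext x
    have h1 : LinearMap.lsum R (fun _ => Z) ℕ q (Pi.single j x) = q j x :=
      LinearMap.lsum_piSingle ..
    exact (congrArg p h1).trans (LinearMap.congr_fun (hq j) x)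
  ext x
  simpa [hri] using LinearMap.congr_fun this (i x)

theorem InAdd.of_projective [Module.Finite R X] [Module.Projective R X] : InAdd R X R := by
  obtain ⟨n, r, hr⟩ := Module.Finite.exists_fin' R X
  obtain ⟨i, hi⟩ := Module.projective_lifting_property r LinearMap.id hr
  exact inAdd_of_retract_pi i r (LinearMap.congr_fun hi)

end InAdd

/-! ### Modules annihilated by the radical -/

section Semisimple

variable {R M : Type u} [Ring R] [IsArtinianRing R] [AddCommGroup M] [Module R M]

/-- M is a module over the quotient by the radical, a semisimple ring because R is Artinian, and the
identity of M is semilinear over the quotient map. -/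
theorem isSemisimpleModule_of_jacobson_smul_eq_zero
    (h : ∀ r ∈ Ring.jacobson R, ∀ m : M, r • m = 0) : IsSemisimpleModule R M := by
  have ht : Module.IsTorsionBySet R M (Ring.jacobson R) := fun m r => h r r.2 m
  let _ := ht.module
  exact (ht.semilinearMap.isSemisimpleModule_iff_of_bijective Function.bijective_id).2
    inferInstance

end Semisimple

/-! ### Common summands by Fitting's lemma -/

section Fitting

variable {R M : Type u} [Ring R] [AddCommGroup M] [Module R M] [IsArtinian R M] [IsNoetherian R M]

/-- If an endomorphism of `M` that factors through `X` has a nonzero fixed point, then `M` and `X`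
have a common nonzero direct summand. -/
theorem exists_common_summand {X : Type u} [AddCommGroup X] [Module R X] (h : M →ₗ[R] X)
    (g : X →ₗ[R] M) {s : M} (hs : s ≠ 0) (hgs : g (h s) = s) :
    ∃ P Q : Submodule R X, IsCompl P Q ∧ P ≠ ⊥ ∧ InAdd R P M := by
  -- Fitting: for large N, M is the direct sum of kernel and range of e^N, where e = g ∘ h. The
  -- range U contains s, and h embeds it in X as a summand. N must be nonzero so that 2N ≥ N + 1 in
  -- the injectivity argument.
  obtain ⟨n, hn, hc⟩ := ((Filter.eventually_ne_atTop 0).and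
    (g ∘ₗ h : Module.End R M).eventually_isCompl_ker_pow_range_pow).exists
  set e : Module.End R M := g ∘ₗ h with he
  obtain ⟨n, rfl⟩ := Nat.exists_eq_succ_of_ne_zero hn
  set U := LinearMap.range (e ^ (n + 1))
  have hsn (m : ℕ) : (e ^ m) s = s := by
    induction m with
    | zero => rfl
    | succ m ih => rw [pow_succ, Module.End.mul_apply, he, LinearMap.comp_apply, hgs, ih]
  let i : U →ₗ[R] X := h ∘ₗ U.subtype
  let p : X →ₗ[R] U := (e ^ (n + 1)).rangeRestrict ∘ₗ g
  have hinj : Function.Injective (p ∘ₗ i) := by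
    rw [← LinearMap.ker_eq_bot, LinearMap.ker_eq_bot']
    rintro ⟨x, hx⟩ h0
    have h1 : (e ^ (n + 1)) (e x) = 0 := congrArg Subtype.val h0
    have h2 : (e ^ (n + 1 + 1)) x = 0 := h1
    have h3 : (e ^ (n + 1)) x ∈ LinearMap.ker (e ^ (n + 1)) := by
      rw [LinearMap.mem_ker, ← Module.End.mul_apply, ← pow_add,
        show n + 1 + (n + 1) = n + (n + 1 + 1) by ring, pow_add, Module.End.mul_apply, h2, map_zero]
    have h4 := (Submodule.disjoint_def.1 hc.disjoint) _ h3 ⟨x, rfl⟩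
    exact Subtype.ext ((Submodule.disjoint_def.1 hc.disjoint) x h4 hx)
  let v : U ≃ₗ[R] U := LinearEquiv.ofBijective (p ∘ₗ i)
    (IsArtinian.bijective_of_injective_endomorphism _ hinj)
  let r : X →ₗ[R] U := v.symm.toLinearMap ∘ₗ p
  have hr (x : U) : r (i x) = x := v.symm_apply_apply x
  have hi : Function.Injective i := Function.LeftInverse.injective hr
  refine ⟨LinearMap.range i, LinearMap.ker (i.rangeRestrict ∘ₗ r),
    LinearMap.isCompl_of_proj (f := i.rangeRestrict ∘ₗ r) ?_, ?_, ?_⟩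
  · rintro ⟨_, x, rfl⟩
    ext1
    simp [hr]
  · intro h0
    rw [LinearMap.range_eq_bot] at h0
    have h1 : (⟨s, s, hsn _⟩ : U) = 0 := hi (by rw [h0]; rfl)
    exact hs (congrArg Subtype.val h1)
  · exact ((InAdd.refl R M).of_isCompl hc.symm).of_equiv (LinearEquiv.ofInjective i hi).symm

end Fitting

/-! ### Projective covers over an Artinian ring -/

section ProjectiveCover

variable {R T : Type u} [Ring R] [IsArtinianRing R] [AddCommGroup T] [Module R T]

/-- A surjection from a projective module whose kernel is not contained in the radical is still
surjective on some proper direct summand. -/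
theorem exists_projective_lt {P : Type u} [AddCommGroup P] [Module R P] [Module.Finite R P]
    [Module.Projective R P] (q : P →ₗ[R] T)
    (hker : ¬ LinearMap.ker q ≤ Ring.jacobson R • (⊤ : Submodule R P)) :
    ∃ K : Submodule R P, K ≠ ⊤ ∧ Module.Projective R K ∧ K.map q = LinearMap.range q := by
  set JP := Ring.jacobson R • (⊤ : Submodule R P)
  have hss : IsSemisimpleModule R (P ⧸ JP) := by
    refine isSemisimpleModule_of_jacobson_smul_eq_zero fun r hr m => ?_
    obtain ⟨m, rfl⟩ := JP.mkQ_surjective m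
    rw [← map_smul]
    exact (Submodule.Quotient.mk_eq_zero _).2 (Submodule.smul_mem_smul hr trivial)
  obtain ⟨C, hC⟩ := exists_isCompl ((LinearMap.ker q).map JP.mkQ)
  set c := ((LinearMap.ker q).map JP.mkQ).projectionOnto C hC
  -- The projection of P/JP onto the image of ker q lifts to an endomorphism e' of P with values in
  -- ker q. In the Fitting decomposition of e' the range part is killed by q, so the kernel part has
  -- the same image under q as P.
  obtain ⟨e, he⟩ := Module.projective_lifting_property
    (JP.mkQ.submoduleMap (LinearMap.ker q)) (c ∘ₗ JP.mkQ) (JP.mkQ.submoduleMap_surjective _)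
  let e' : Module.End R P := (LinearMap.ker q).subtype ∘ₗ e
  have he' (x : P) : JP.mkQ (e' x) = c (JP.mkQ x) :=
    congrArg Subtype.val (LinearMap.congr_fun he x)
  have hen (n : ℕ) (x : P) : JP.mkQ ((e' ^ (n + 1)) x) = c (JP.mkQ x) := by
    induction n with
    | zero => simpa using he' x
    | succ n ih => rw [pow_succ', Module.End.mul_apply, he', ih]; simp [c]
  obtain ⟨n, hn, hc⟩ := ((Filter.eventually_ne_atTop 0).and
    e'.eventually_isCompl_ker_pow_range_pow).exists
  obtain ⟨n, rfl⟩ := Nat.exists_eq_succ_of_ne_zero hn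
  have hq (x : P) : q ((e' ^ (n + 1)) x) = 0 := by
    rw [pow_succ', Module.End.mul_apply]
    exact (e _).2
  refine ⟨LinearMap.ker (e' ^ (n + 1)), fun h => hker ?_, ?_, ?_⟩
  · intro x hx
    rw [← Submodule.ker_mkQ JP, LinearMap.mem_ker]
    have h1 := hen n x
    rw [LinearMap.ker_eq_top.1 h, LinearMap.zero_apply, map_zero] at h1
    have h2 := Submodule.projectionOnto_apply_left hC ⟨JP.mkQ x, x, hx, rfl⟩
    exact (congrArg Subtype.val h2).symm.trans h1.symm
  · exact Module.Projective.of_split (LinearMap.ker (e' ^ (n + 1))).subtype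
      (Submodule.projectionOnto _ _ hc) (by ext; simp)
  · refine le_antisymm (LinearMap.map_le_range) ?_
    rintro _ ⟨x, rfl⟩
    obtain ⟨a, ha, _, ⟨b, rfl⟩, rfl⟩ := Submodule.mem_sup.1
      (hc.sup_eq_top ▸ Submodule.mem_top : x ∈ _)
    exact ⟨a, ha, by simp [hq]⟩

/-- A finitely generated module that is annihilated by the radical has a projective cover. -/
theorem exists_projective_cover [Module.Finite R T]
    (hT : ∀ r ∈ Ring.jacobson R, ∀ t : T, r • t = 0) :
    ∃ (n : ℕ) (P : Submodule R (Fin n → R)) (q : P →ₗ[R] T), Module.Projective R P ∧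
      Function.Surjective q ∧ LinearMap.ker q = Ring.jacobson R • ⊤ := by
  obtain ⟨n, q, hq⟩ := Module.Finite.exists_fin' R T
  -- A minimal projective submodule of R^n that still maps onto T: if its kernel were not in the
  -- radical, `exists_projective_lt` would give a smaller one.
  obtain ⟨P, ⟨hP, hPq⟩, hmin⟩ := WellFounded.has_min (wellFounded_lt (α := Submodule R (Fin n → R)))
    {P | Module.Projective R P ∧ P.map q = ⊤}
    ⟨⊤, Module.Projective.of_equiv Submodule.topEquiv.symm,
      by rw [Submodule.map_top, LinearMap.range_eq_top.2 hq]⟩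
  have hsurj : LinearMap.range (q ∘ₗ P.subtype) = ⊤ := by
    rw [LinearMap.range_comp, Submodule.range_subtype, hPq]
  refine ⟨n, P, q ∘ₗ P.subtype, hP, LinearMap.range_eq_top.1 hsurj, le_antisymm ?_ ?_⟩
  · by_contra hker
    obtain ⟨K, hK, hKp, hKq⟩ := exists_projective_lt (q ∘ₗ P.subtype) hker
    refine hmin (K.map P.subtype) ⟨?_, ?_⟩ ?_
    · exact Module.Projective.of_equiv
        (Submodule.equivMapOfInjective P.subtype P.injective_subtype K)
    · rw [← Submodule.map_comp, hKq, hsurj]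
    · refine lt_of_le_of_ne (Submodule.map_subtype_le _ _) fun h => hK ?_
      refine Submodule.map_injective_of_injective P.injective_subtype ?_
      rw [h, Submodule.map_subtype_top]
  · rw [Submodule.smul_le]
    intro r hr x _
    rw [LinearMap.mem_ker, map_smul, hT r hr]

end ProjectiveCover

/-! ### Projective dimension and syzygies -/

section ProjectiveDimension

variable {E P M : Type u} [Ring E] [AddCommGroup P] [Module E P] [AddCommGroup M] [Module E M]

theorem hasProjectiveDimensionLT_of_surjective [Module.Projective E P] (p : P →ₗ[E] M)
    (hp : Function.Surjective p) (n : ℕ)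
    (h : HasProjectiveDimensionLT (ModuleCat.of E (LinearMap.ker p)) (n + 1)) :
    HasProjectiveDimensionLT (ModuleCat.of E M) (n + 2) := by
  have hs := LinearMap.shortExact_shortComplexKer hp
  have : Projective (ModuleCat.of E P) := ModuleCat.projective_of_categoryTheory_projective _
  exact hs.hasProjectiveDimensionLT_X₃ (n + 1) h
    (inferInstanceAs (HasProjectiveDimensionLT (ModuleCat.of E P) (n + 1 + 1)))

theorem hasProjectiveDimensionLT_one [Module.Projective E P] :
    HasProjectiveDimensionLT (ModuleCat.of E P) 1 := by
  have : Projective (ModuleCat.of E P) := ModuleCat.projective_of_categoryTheory_projective _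
  infer_instance

end ProjectiveDimension

/-! ### The functor Hom_A(Z, -) and the bound on the global dimension -/

section HomFunctor

variable {A Z X Y : Type u} [Ring A] [AddCommGroup Z] [Module A Z] [AddCommGroup X] [Module A X]
  [AddCommGroup Y] [Module A Y]

/-- The left module `Hom_A(Z, X)` over the endomorphism ring of `Z`. -/
instance homModule : Module (EndRing A Z) (Z →ₗ[A] X) where
  smul e g := g ∘ₗ e.unop
  one_smul _ := rfl
  mul_smul _ _ _ := rfl
  smul_zero _ := rfl
  smul_add _ _ _ := rfl
  add_smul e e' g := LinearMap.comp_add e.unop e'.unop g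
  zero_smul g := LinearMap.comp_zero g

theorem endRing_smul_def (e : EndRing A Z) (g : Z →ₗ[A] X) : e • g = g ∘ₗ e.unop := rfl

variable (Z) in
/-- The map `Hom_A(Z, X) → Hom_A(Z, Y)` induced by `p : X → Y`. -/
def postcomp (p : X →ₗ[A] Y) : (Z →ₗ[A] X) →ₗ[EndRing A Z] (Z →ₗ[A] Y) where
  toFun g := p ∘ₗ g
  map_add' g g' := LinearMap.comp_add g g' p
  map_smul' _ _ := rfl

@[simp]
theorem postcomp_apply (p : X →ₗ[A] Y) (g : Z →ₗ[A] X) : postcomp Z p g = p ∘ₗ g := rfl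

variable (A Z) in
/-- `Hom_A(Z, Z^n)` is free of rank `n` over the endomorphism ring of `Z`. -/
def homPiEquiv (n : ℕ) : (Z →ₗ[A] (Fin n → Z)) ≃ₗ[EndRing A Z] (Fin n → EndRing A Z) where
  toFun g j := MulOpposite.op (LinearMap.proj j ∘ₗ g)
  invFun x := LinearMap.pi fun j => (x j).unop
  map_add' _ _ := rfl
  map_smul' _ _ := rfl
  left_inv _ := rfl
  right_inv _ := rfl

theorem InAdd.projective_hom (h : InAdd A X Z) : Module.Projective (EndRing A Z) (Z →ₗ[A] X) := by
  obtain ⟨n, i, r, hri⟩ := h.exists_retract_pi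
  have : Module.Projective (EndRing A Z) (Z →ₗ[A] (Fin n → Z)) :=
    Module.Projective.of_equiv (homPiEquiv A Z n).symm
  refine Module.Projective.of_split (postcomp Z i) (postcomp Z r) ?_
  ext g z
  exact hri (g z)

/-- Yoneda: all linear maps `Hom_A(Z, Z^n) → Hom_A(Z, Y)` are induced by maps `Z^n → Y`. -/
theorem exists_postcomp_eq {n : ℕ}
    (φ : (Z →ₗ[A] (Fin n → Z)) →ₗ[EndRing A Z] (Z →ₗ[A] Y)) :
    ∃ d : (Fin n → Z) →ₗ[A] Y, φ = postcomp Z d := by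
  refine ⟨∑ j, φ (LinearMap.single A (fun _ => Z) j) ∘ₗ LinearMap.proj j, ?_⟩
  ext g z
  have hg : g = ∑ j, (MulOpposite.op (LinearMap.proj j ∘ₗ g) : EndRing A Z) •
      LinearMap.single A (fun _ => Z) j := by
    ext z j
    simp [endRing_smul_def, Pi.single_apply]
  have hφ := congrArg φ hg
  rw [map_sum] at hφ
  simp only [map_smul] at hφ
  rw [hφ]
  simp [endRing_smul_def]

/-- `Hom_A(Z, -)` preserves kernels. -/
def homKerEquiv (p : X →ₗ[A] Y) :
    (Z →ₗ[A] LinearMap.ker p) ≃ₗ[EndRing A Z] LinearMap.ker (postcomp Z p) where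
  toFun g := ⟨(LinearMap.ker p).subtype ∘ₗ g, by ext z; exact (g z).2⟩
  invFun g := LinearMap.codRestrict _ g.1 fun z => LinearMap.congr_fun g.2 z
  map_add' _ _ := rfl
  map_smul' _ _ := rfl
  left_inv _ := rfl
  right_inv _ := rfl

/-- A right `add(Z)`-approximation `p : M → X` whose kernel lies in `add(Z)` exists. -/
def HasApproximation (A X Z : Type u) [Ring A] [AddCommGroup Z] [Module A Z] [AddCommGroup X]
    [Module A X] : Prop :=
  ∃ (M : ModuleCat.{u} A) (p : M →ₗ[A] X), InAdd A M Z ∧ InAdd A (LinearMap.ker p) Z ∧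
    ∀ g : Z →ₗ[A] X, ∃ g' : Z →ₗ[A] M, p ∘ₗ g' = g

/-- A second syzygy over the endomorphism ring has the form Hom_A(Z, ker d), by Yoneda and left
exactness. An approximation of ker d resolves it by projectives in length 1, and 1 + 2 = 3. -/
theorem gldim_endRing_le_three [IsNoetherianRing A] [Module.Finite A Z]
    [IsNoetherianRing (EndRing A Z)]
    (h : ∀ (X : Type u) [AddCommGroup X] [Module A X], Module.Finite A X →
      HasApproximation A X Z) :
    gldim (EndRing A Z) ≤ 3 := by
  refine iSup₂_le fun W hW => (projectiveDimension_le_iff W 3).2 ?_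
  obtain ⟨n, s, hs⟩ := Module.Finite.exists_fin' (EndRing A Z) W
  obtain ⟨m, t, ht⟩ := Module.Finite.exists_fin' (EndRing A Z) (LinearMap.ker s)
  obtain ⟨d, hd⟩ := exists_postcomp_eq ((homPiEquiv A Z n).symm.toLinearMap ∘ₗ
    (LinearMap.ker s).subtype ∘ₗ t ∘ₗ (homPiEquiv A Z m).toLinearMap)
  obtain ⟨M, p, hM, hK, hp⟩ := h (LinearMap.ker d) inferInstance
  have := hM.projective_hom
  have := hK.projective_hom
  have hd' (g) : t (homPiEquiv A Z m g) = 0 ↔ d ∘ₗ g = 0 := by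
    rw [← postcomp_apply, ← hd]
    simp
  let q : (Z →ₗ[A] M) →ₗ[EndRing A Z] LinearMap.ker t := LinearMap.codRestrict _
    ((homPiEquiv A Z m).toLinearMap ∘ₗ postcomp Z ((LinearMap.ker d).subtype ∘ₗ p)) fun g =>
      (hd' _).2 (by ext1 z; exact (p (g z)).2)
  have hq : Function.Surjective q := by
    rintro ⟨y, hy⟩
    obtain ⟨g, rfl⟩ := (homPiEquiv A Z m).surjective y
    obtain ⟨g', hg'⟩ := hp (LinearMap.codRestrict _ g fun z => LinearMap.congr_fun ((hd' g).1 hy) z)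
    refine ⟨g', Subtype.ext (congrArg (homPiEquiv A Z m) ?_)⟩
    ext1 z
    exact congrArg Subtype.val (LinearMap.congr_fun hg' z)
  have hkq : LinearMap.ker q = LinearMap.ker (postcomp Z p) := by
    ext g
    rw [LinearMap.mem_ker, LinearMap.mem_ker, ← Subtype.coe_inj]
    change homPiEquiv A Z m (postcomp Z ((LinearMap.ker d).subtype ∘ₗ p) g) = 0 ↔ _
    rw [LinearEquiv.map_eq_zero_iff]
    refine ⟨fun hg => ?_, fun hg => ?_⟩
    · ext1 z
      exact Subtype.ext (LinearMap.congr_fun hg z)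
    · ext1 z
      exact congrArg Subtype.val (LinearMap.congr_fun hg z)
  have : Module.Projective (EndRing A Z) (LinearMap.ker q) := by
    rw [hkq]
    exact Module.Projective.of_equiv (homKerEquiv p)
  -- The strict bounds run through 1, 2, 3, 4, and "less than 4" is the required "at most 3".
  exact hasProjectiveDimensionLT_of_surjective s hs 2
    (hasProjectiveDimensionLT_of_surjective t ht 1
      (hasProjectiveDimensionLT_of_surjective q hq 0 hasProjectiveDimensionLT_one))

end HomFunctor

/-! ### The injective cogenerator A^* and its socle -/

section Dual

variable (k A : Type u) [Field k] [Ring A] [Algebra k A]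

/-- The value of a linear form on `A`. -/
def DualModule.eval (x : A) : DualModule k A →+ k where
  toFun φ := (show A →ₗ[k] k from φ) x
  map_zero' := rfl
  map_add' _ _ := rfl

variable {k A}

@[ext]
theorem DualModule.ext {φ ψ : DualModule k A} (h : ∀ x, eval k A x φ = eval k A x ψ) : φ = ψ :=
  LinearMap.ext h

@[simp]
theorem DualModule.eval_smul (a x : A) (φ : DualModule k A) :
    eval k A x (a • φ) = eval k A (x * a) φ := rfl

theorem DualModule.eval_smul_left (c : k) (x : A) (φ : DualModule k A) :
    eval k A (c • x) φ = c * eval k A x φ :=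
  map_smul (show A →ₗ[k] k from φ) c x

variable (k A)

theorem finite_dualModule [FiniteDimensional k A] : Module.Finite A (DualModule k A) := by
  let _ : Module k (DualModule k A) := inferInstanceAs (Module k (Module.Dual k A))
  have : Module.Finite k (DualModule k A) := inferInstanceAs (Module.Finite k (Module.Dual k A))
  have : IsScalarTower k A (DualModule k A) := ⟨fun c a φ => by
    ext x
    change DualModule.eval k A (x * (c • a)) φ = c * DualModule.eval k A (x * a) φ
    rw [mul_smul_comm, DualModule.eval_smul_left]⟩
  exact Module.Finite.of_restrictScalars_finite k A _

/-- Evaluation at 1 identifies Hom_A(Y, A^*) with Hom_k(Y, k), and linear forms extend along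
injections of vector spaces. -/
theorem injective_dualModule : Module.Injective A (DualModule k A) where
  out X Y _ _ _ _ f hf g := by
    let _ : Module k X := Module.compHom X (algebraMap k A)
    let _ : Module k Y := Module.compHom Y (algebraMap k A)
    have hX (c : k) (x : X) : c • x = algebraMap k A c • x := rfl
    have hY (c : k) (y : Y) : c • y = algebraMap k A c • y := rfl
    let f' : X →ₗ[k] Y :=
      { toFun := f, map_add' := map_add f, map_smul' := fun c x => map_smul f (algebraMap k A c) x }
    let φ : X →ₗ[k] k :=
      { toFun := fun x => DualModule.eval k A 1 (g x)
        map_add' := fun x y => by simp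
        map_smul' := fun c x => by
          rw [hX, map_smul, DualModule.eval_smul, one_mul, Algebra.algebraMap_eq_smul_one,
            DualModule.eval_smul_left]
          rfl }
    obtain ⟨l, hl⟩ := f'.exists_leftInverse_of_injective (LinearMap.ker_eq_bot.2 hf)
    have hl' (x : X) : l (f x) = x := LinearMap.congr_fun hl x
    let ψ : Y →ₗ[A] DualModule k A :=
      { toFun := fun y =>
          { toFun := fun a => φ (l (a • y))
            map_add' := fun a b => by rw [add_smul, map_add, map_add]
            map_smul' := fun c a => by
              rw [Algebra.smul_def, mul_smul, ← hY, map_smul, map_smul]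
              rfl }
        map_add' := fun y z => LinearMap.ext fun a => by
          change φ (l (a • (y + z))) = φ (l (a • y)) + φ (l (a • z))
          rw [smul_add, map_add, map_add]
        map_smul' := fun b y => LinearMap.ext fun a => by
          change φ (l (a • b • y)) = φ (l ((a * b) • y))
          rw [mul_smul] }
    refine ⟨ψ, fun x => ?_⟩
    ext a
    change φ (l (a • f x)) = _
    rw [← map_smul, hl']
    change DualModule.eval k A 1 (g (a • x)) = _
    rw [map_smul, DualModule.eval_smul, one_mul]

/-- The linear forms on `A` that vanish on the radical, that is, the socle of `A^*`. -/
def dualSocle : Submodule A (DualModule k A) where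
  carrier := {φ | ∀ a ∈ Ring.jacobson A, DualModule.eval k A a φ = 0}
  zero_mem' _ _ := map_zero _
  add_mem' h h' a ha := by rw [map_add, h a ha, h' a ha, add_zero]
  smul_mem' x φ h a ha := by
    rw [DualModule.eval_smul]
    exact h _ (Ideal.IsTwoSided.mul_mem_of_left x ha)

instance [FiniteDimensional k A] : IsSemisimpleModule A (dualSocle k A) := by
  have : IsArtinianRing A := IsArtinianRing.of_finite k A
  refine isSemisimpleModule_of_jacobson_smul_eq_zero fun r hr φ => ?_
  ext x
  exact φ.2 _ (Ideal.mul_mem_left _ x hr)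

variable {k A} in
/-- A module with a map from `A^*` that does not kill the socle has a nonzero direct summand in
`add(A^*)`. -/
theorem exists_summand_of_dualModule [FiniteDimensional k A] {X : Type u} [AddCommGroup X]
    [Module A X] (h : DualModule k A →ₗ[A] X) {φ : DualModule k A} (hφ : φ ∈ dualSocle k A)
    (h0 : h φ ≠ 0) :
    ∃ P Q : Submodule A X, IsCompl P Q ∧ P ≠ ⊥ ∧ InAdd A P (DualModule k A) := by
  have : IsArtinianRing A := IsArtinianRing.of_finite k A
  have := finite_dualModule k A
  -- The socle is semisimple, so its surjection onto h(soc) has a section σ. Injectivity of A^*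
  -- extends σ to g : X → A^*, and then g ∘ h fixes the nonzero element σ(h φ).
  obtain ⟨σ, hσ⟩ := IsSemisimpleModule.lifting_property
    (h ∘ₗ (dualSocle k A).subtype).rangeRestrict (LinearMap.surjective_rangeRestrict _)
    LinearMap.id
  obtain ⟨g, hg⟩ := (injective_dualModule k A).out
    (LinearMap.range (h ∘ₗ (dualSocle k A).subtype)).subtype (Submodule.injective_subtype _)
    ((dualSocle k A).subtype ∘ₗ σ)
  let y : LinearMap.range (h ∘ₗ (dualSocle k A).subtype) := ⟨h φ, ⟨φ, hφ⟩, rfl⟩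
  have hy : h (σ y) = h φ := congrArg Subtype.val (LinearMap.congr_fun hσ y)
  refine exists_common_summand h g (s := σ y) (fun hs => h0 ?_) ?_
  · rw [← hy, hs, map_zero]
  · rw [hy]
    exact hg y

end Dual

/-! ### Coinduction from A to B -/

section Coinduced

variable (A B : Type u) [Ring A] [Ring B] [Module A B] [IsScalarTower A B B]

/-- The coinduced `B`-module `Hom_A(B, X)`. -/
def Coind (X : Type u) [AddCommGroup X] [Module A X] : Type u := B →ₗ[A] X

variable (X : Type u) [AddCommGroup X] [Module A X]

instance : AddCommGroup (Coind A B X) := inferInstanceAs (AddCommGroup (B →ₗ[A] X))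

instance : FunLike (Coind A B X) B X := inferInstanceAs (FunLike (B →ₗ[A] X) B X)

instance : Module B (Coind A B X) where
  smul b h :=
    { toFun := fun x => (show B →ₗ[A] X from h) (x * b)
      map_add' := fun x y => by rw [add_mul, map_add]
      map_smul' := fun a x => by rw [smul_mul_assoc, map_smul]; rfl }
  one_smul h := LinearMap.ext fun x => congrArg (show B →ₗ[A] X from h) (mul_one x)
  mul_smul b c h := LinearMap.ext fun x =>
    congrArg (show B →ₗ[A] X from h) (mul_assoc x b c).symm
  smul_zero _ := rfl
  smul_add _ _ _ := rfl
  add_smul b c h := LinearMap.ext fun x =>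
    (congrArg (show B →ₗ[A] X from h) (mul_add x b c)).trans (map_add _ _ _)
  zero_smul h := LinearMap.ext fun x =>
    (congrArg (show B →ₗ[A] X from h) (mul_zero x)).trans (map_zero _)

/-- A acts through B, hence on the argument. Acting on values would not preserve A-linearity for
noncommutative A. -/
instance : Module A (Coind A B X) := Module.compHom _ (RingHom.smulOneHom : A →+* B)

variable {A B X}

omit [IsScalarTower A B B] in
@[ext]
theorem Coind.ext {h h' : Coind A B X} (H : ∀ b, h b = h' b) : h = h' := LinearMap.ext H

@[simp]
theorem Coind.smul_apply (b x : B) (h : Coind A B X) : (b • h) x = h (x * b) := rfl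

omit [IsScalarTower A B B] in
theorem Coind.map_smul (a : A) (h : Coind A B X) (x : B) : h (a • x) = a • h x :=
  LinearMap.map_smul (show B →ₗ[A] X from h) a x

theorem Coind.restrict_smul (a : A) (h : Coind A B X) : a • h = (a • (1 : B)) • h := rfl

instance : IsScalarTower A B (Coind A B X) := ⟨fun a b h => by
  rw [Coind.restrict_smul, ← mul_smul, smul_one_mul]⟩

variable (A B X) in
/-- The counit `Hom_A(B, X) → X`, evaluation at `1`. -/
def Coind.counit : Coind A B X →ₗ[A] X where
  toFun h := h 1
  map_add' _ _ := rfl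
  map_smul' a h := by
    rw [Coind.restrict_smul, Coind.smul_apply, one_mul, Coind.map_smul]
    rfl

/-- The map `Y → Hom_A(B, X)` corresponding to an `A`-linear map `Y → X` on a `B`-module `Y`. -/
def Coind.lift {Y : Type u} [AddCommGroup Y] [Module A Y] [Module B Y] [IsScalarTower A B Y]
    (g : Y →ₗ[A] X) : Y →ₗ[A] Coind A B X where
  toFun y :=
    { toFun := fun b => g (b • y)
      map_add' := fun b c => by rw [add_smul, map_add]
      map_smul' := fun a b => by rw [smul_assoc, LinearMap.map_smul]; rfl }
  map_add' y z := LinearMap.ext fun b =>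
    (congrArg g (smul_add b y z)).trans (map_add g _ _)
  map_smul' a y := LinearMap.ext fun b => by
    change g (b • a • y) = g ((b * (a • (1 : B))) • y)
    rw [mul_smul, smul_assoc, one_smul]

theorem Coind.counit_comp_lift {Y : Type u} [AddCommGroup Y] [Module A Y] [Module B Y]
    [IsScalarTower A B Y] (g : Y →ₗ[A] X) : Coind.counit A B X ∘ₗ Coind.lift g = g := by
  ext y
  exact congrArg g (one_smul B y)

variable (A B X) in
theorem Coind.finite (k : Type u) [Field k] [Algebra k A] [Algebra k B] [IsScalarTower k A B]
    [FiniteDimensional k A] [FiniteDimensional k B] [Module.Finite A X] :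
    Module.Finite B (Coind A B X) := by
  let _ : Module k X := Module.compHom X (algebraMap k A)
  have hX (c : k) (x : X) : c • x = algebraMap k A c • x := rfl
  have : IsScalarTower k A X := ⟨fun c a x => by rw [hX, ← mul_smul, Algebra.smul_def]⟩
  have : Module.Finite k X := Module.Finite.trans A X
  let _ : Module k (Coind A B X) := Module.compHom _ (algebraMap k B)
  have hC (c : k) (h : Coind A B X) : c • h = algebraMap k B c • h := rfl
  have : IsScalarTower k B (Coind A B X) :=
    ⟨fun c a x => by rw [hC, ← mul_smul, Algebra.smul_def]⟩
  let i : Coind A B X →ₗ[k] (B →ₗ[k] X) :=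
    { toFun := fun h => (show B →ₗ[A] X from h).restrictScalars k
      map_add' := fun _ _ => rfl
      map_smul' := fun c h => LinearMap.ext fun x => by
        change h (x * algebraMap k B c) = c • h x
        rw [← Algebra.commutes, ← Algebra.smul_def, ← algebraMap_smul A c x, Coind.map_smul]
        rfl }
  have : Module.Finite k (Coind A B X) := Module.Finite.of_injective i fun h h' H =>
    Coind.ext fun b => LinearMap.congr_fun H b
  exact Module.Finite.of_restrictScalars_finite k B _

end Coinduced

/-! ### The radical of a projective module -/

section Radical

variable {R P : Type u} [Ring R] [AddCommGroup P] [Module R P]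

/-- The two maps exhibiting P as a retract of R^n are linear, so they restrict to JP and J^n. -/
theorem inAdd_jacobson_smul_top (hP : InAdd R P R) :
    InAdd R (Ring.jacobson R • ⊤ : Submodule R P) (Ring.jacobson R) := by
  obtain ⟨n, i, r, hri⟩ := hP.exists_retract_pi
  have hi (x : P) (hx : x ∈ (Ring.jacobson R • ⊤ : Submodule R P)) (j : Fin n) :
      i x j ∈ Ring.jacobson R := by
    refine Submodule.smul_induction_on (p := fun x => i x j ∈ Ring.jacobson R) hx
      (fun a ha x _ => ?_) fun x y hx hy => ?_
    · rw [map_smul]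
      exact Ideal.IsTwoSided.mul_mem_of_left _ ha
    · rw [map_add]
      exact add_mem hx hy
  let i' : (Ring.jacobson R • ⊤ : Submodule R P) →ₗ[R] (Fin n → Ring.jacobson R) :=
    LinearMap.pi fun j => LinearMap.codRestrict _
      (LinearMap.proj j ∘ₗ i ∘ₗ Submodule.subtype _) fun x => hi x x.2 j
  let v : (Fin n → Ring.jacobson R) →ₗ[R] (Fin n → R) :=
    LinearMap.pi fun j => Submodule.subtype _ ∘ₗ LinearMap.proj j
  have hr (x : Fin n → Ring.jacobson R) : r (v x) ∈ (Ring.jacobson R • ⊤ : Submodule R P) := by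
    have hx : v x = ∑ j, (x j : R) • (Pi.single j 1 : Fin n → R) := by
      ext j
      simp [v, Pi.single_apply]
    rw [hx, map_sum]
    refine sum_mem fun j _ => ?_
    rw [map_smul]
    exact Submodule.smul_mem_smul (x j).2 trivial
  exact inAdd_of_retract_pi i' (LinearMap.codRestrict _ (r ∘ₗ v) hr)
    fun x => Subtype.ext (hri x)

end Radical

/-! ### Approximations and direct summands -/

section Decomposition

variable {A X Z : Type u} [Ring A] [AddCommGroup X] [Module A X] [AddCommGroup Z] [Module A Z]

/-- P approximates itself; adding it to the approximation of Q leaves the kernel unchanged up to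
isomorphism. -/
theorem HasApproximation.of_isCompl {P Q : Submodule A X} (hPQ : IsCompl P Q) (hP : InAdd A P Z)
    (hQ : HasApproximation A Q Z) : HasApproximation A X Z := by
  obtain ⟨M, p, hM, hK, hp⟩ := hQ
  have key (x : P) (m : M) (h : (x : X) + p m = 0) : x = 0 ∧ p m = 0 := by
    have hx : (x : X) ∈ Q := by
      rw [eq_neg_of_add_eq_zero_left h]
      exact neg_mem (p m).2
    have hx0 : (x : X) = 0 := (Submodule.disjoint_def.1 hPQ.disjoint) x x.2 hx
    rw [hx0, zero_add] at h
    exact ⟨Subtype.ext hx0, Subtype.ext h⟩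
  let s : (P × M) →ₗ[A] X := P.subtype.coprod (Q.subtype ∘ₗ p)
  refine ⟨ModuleCat.of A (P × M), s, hP.prod hM, ?_, fun g => ?_⟩
  · refine hK.of_retract
      (LinearMap.codRestrict _ (LinearMap.snd A P M ∘ₗ (LinearMap.ker s).subtype)
        fun x => (key _ _ x.2).2)
      (LinearMap.codRestrict _ (LinearMap.inr A P M ∘ₗ (LinearMap.ker p).subtype) fun x => ?_)
      fun x => Subtype.ext (Prod.ext (key _ _ x.2).1.symm rfl)
    simp [s]
  · obtain ⟨g', hg'⟩ := hp (Q.projectionOnto P hPQ.symm ∘ₗ g)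
    refine ⟨(P.projectionOnto Q hPQ ∘ₗ g).prod g', ?_⟩
    ext z
    have h1 : p (g' z) = Q.projectionOnto P hPQ.symm (g z) := LinearMap.congr_fun hg' z
    change (P.projectionOnto Q hPQ (g z) : X) + p (g' z) = g z
    rw [h1]
    exact Submodule.projection_add_projection_eq_self hPQ (g z)

theorem HasApproximation.of_equiv {Y : Type u} [AddCommGroup Y] [Module A Y] (e : X ≃ₗ[A] Y)
    (h : HasApproximation A X Z) : HasApproximation A Y Z := by
  obtain ⟨M, p, hM, hK, hp⟩ := h
  refine ⟨M, e.toLinearMap ∘ₗ p, hM, ?_, fun g => ?_⟩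
  · rwa [LinearEquiv.ker_comp]
  · obtain ⟨g', hg'⟩ := hp (e.symm.toLinearMap ∘ₗ g)
    refine ⟨g', ?_⟩
    rw [LinearMap.comp_assoc, hg']
    ext z
    simp

/-- If an approximation exists for every submodule from which no nonzero summand in `add(Z)` can
be split off, then one exists for every submodule. -/
theorem HasApproximation.of_forall_summand [IsArtinian A X]
    (h : ∀ W : Submodule A X, (∀ P Q : Submodule A W, IsCompl P Q → InAdd A P Z → P = ⊥) →
      HasApproximation A W Z) : HasApproximation A X Z := by
  refine HasApproximation.of_equiv Submodule.topEquiv ?_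
  -- Working with submodules of a fixed Artinian module makes the splitting-off process terminate:
  -- the complement Q of a nonzero P is strictly smaller than W.
  induction (⊤ : Submodule A X) using WellFoundedLT.induction with
  | _ W ih =>
    by_cases hW : ∀ P Q : Submodule A W, IsCompl P Q → InAdd A P Z → P = ⊥
    · exact h W hW
    · push Not at hW
      obtain ⟨P, Q, hPQ, hP, hP0⟩ := hW
      refine HasApproximation.of_isCompl hPQ hP ?_
      refine HasApproximation.of_equiv
        (Submodule.equivMapOfInjective W.subtype W.injective_subtype Q).symm (ih _ ?_)
      refine lt_of_le_of_ne (Submodule.map_subtype_le _ _) fun hQ => hP0 ?_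
      have : Q = ⊤ := Submodule.map_injective_of_injective W.injective_subtype
        (hQ.trans (Submodule.map_subtype_top W).symm)
      subst this
      exact disjoint_top.1 hPQ.disjoint

end Decomposition

/-! ### Consequences of J_A ≅ J_B -/

section RadicalExtension

variable {A B N X : Type u} [Ring A] [Ring B] [Module A B] [IsScalarTower A B B]
  [AddCommGroup N] [Module A N] [AddCommGroup X] [Module A X]

/-- The scalar action of `A` on `B` comes from an injective ring homomorphism that maps the
radical of `A` onto the radical of `B`. -/
structure IsRadicalExtension (A B : Type u) [Ring A] [Ring B] [Module A B] : Prop where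
  eq_zero : ∀ a : A, a • (1 : B) = 0 → a = 0
  smul_one_mem : ∀ a ∈ Ring.jacobson A, a • (1 : B) ∈ Ring.jacobson B
  exists_smul_one : ∀ b ∈ Ring.jacobson B, ∃ a ∈ Ring.jacobson A, a • (1 : B) = b

/-- All finitely generated `B`-modules are in `add(N)` as `A`-modules. -/
def ContainsRestrictions (A B N : Type u) [Ring A] [Ring B] [Module A B] [AddCommGroup N]
    [Module A N] : Prop :=
  ∀ (Y : Type u) [AddCommGroup Y] [Module A Y] [Module B Y] [IsScalarTower A B Y],
    Module.Finite B Y → InAdd A Y N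

omit [IsScalarTower A B B] in
theorem IsRadicalExtension.mem_jacobson (h : IsRadicalExtension A B) {a : A}
    (ha : a • (1 : B) ∈ Ring.jacobson B) : a ∈ Ring.jacobson A := by
  obtain ⟨a', ha', h'⟩ := h.exists_smul_one _ ha
  rwa [← sub_eq_zero.1 (h.eq_zero (a' - a) (by rw [sub_smul, h', sub_self]))]

/-- The embedding identifies J_A, as an A-module, with J_B, which is a finitely generated B-module.
-/
theorem ContainsRestrictions.inAdd_jacobson [IsNoetherianRing B] (hN : ContainsRestrictions A B N)
    (h : IsRadicalExtension A B) : InAdd A (Ring.jacobson A) N := by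
  let l : Ring.jacobson A →ₗ[A] Ring.jacobson B :=
    { toFun := fun a => ⟨(a : A) • (1 : B), h.smul_one_mem a a.2⟩
      map_add' := fun a a' => Subtype.ext (add_smul _ _ _)
      map_smul' := fun a a' => Subtype.ext (mul_smul a (a' : A) (1 : B)) }
  refine (hN (Ring.jacobson B) inferInstance).of_equiv (LinearEquiv.ofBijective l ⟨?_, ?_⟩)
  · rw [← LinearMap.ker_eq_bot, LinearMap.ker_eq_bot']
    exact fun a ha => Subtype.ext (h.eq_zero a (congrArg Subtype.val ha))
  · rintro ⟨b, hb⟩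
    obtain ⟨a, ha, rfl⟩ := h.exists_smul_one b hb
    exact ⟨⟨a, ha⟩, rfl⟩

/-- X is a quotient of (A/J_A)^n, which embeds in V = (B/J_B)^n. As V is semisimple over A, the
surjection onto X extends to V and splits. -/
theorem ContainsRestrictions.inAdd_of_jacobson_smul_eq_zero [IsArtinianRing A]
    (hN : ContainsRestrictions A B N) (h : IsRadicalExtension A B)
    [Module.Finite A X] (hX : ∀ r ∈ Ring.jacobson A, ∀ x : X, r • x = 0) : InAdd A X N := by
  obtain ⟨n, r, hr⟩ := Module.Finite.exists_fin' A X
  let V := Fin n → B ⧸ Ring.jacobson B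
  have hV : InAdd A V N := InAdd.pi fun _ => hN _ inferInstance
  have : IsSemisimpleModule A V := by
    refine isSemisimpleModule_of_jacobson_smul_eq_zero fun a ha v => funext fun j => ?_
    obtain ⟨b, hb⟩ := Submodule.Quotient.mk_surjective _ (v j)
    rw [Pi.smul_apply, ← hb, ← Submodule.Quotient.mk_smul]
    refine (Submodule.Quotient.mk_eq_zero _).2 ?_
    rw [← smul_one_mul]
    exact Ideal.IsTwoSided.mul_mem_of_left b (h.smul_one_mem a ha)
  let ι : (Fin n → A) →ₗ[A] V :=
    { toFun := fun x j => Submodule.Quotient.mk (x j • (1 : B))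
      map_add' := fun x y => funext fun j => by
        simp only [Pi.add_apply, add_smul, Submodule.Quotient.mk_add]
        rfl
      map_smul' := fun a x => funext fun j => by
        simp only [Pi.smul_apply, smul_eq_mul, mul_smul, Submodule.Quotient.mk_smul,
          RingHom.id_apply]
        rfl }
  have hker : LinearMap.ker ι ≤ LinearMap.ker r := fun x hx => by
    have hx' (j) : x j ∈ Ring.jacobson A :=
      h.mem_jacobson ((Submodule.Quotient.mk_eq_zero _).1 (congrFun hx j))
    have hs : x = ∑ j, x j • (Pi.single j 1 : Fin n → A) := by
      ext j
      simp [Pi.single_apply]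
    rw [LinearMap.mem_ker, hs, map_sum]
    refine Finset.sum_eq_zero fun j _ => ?_
    rw [map_smul]
    exact hX _ (hx' j) _
  obtain ⟨p, hp⟩ := IsSemisimpleModule.extension_property ((LinearMap.ker ι).liftQ ι le_rfl)
    (LinearMap.ker_eq_bot.1 (Submodule.ker_liftQ_eq_bot _ _ _ le_rfl))
    ((LinearMap.ker ι).liftQ r hker)
  have hps : Function.Surjective p := fun x => by
    obtain ⟨y, rfl⟩ := hr x
    exact ⟨ι y, LinearMap.congr_fun hp (Submodule.Quotient.mk y)⟩
  obtain ⟨s, hs⟩ := IsSemisimpleModule.lifting_property p hps LinearMap.id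
  exact hV.of_retract s p (LinearMap.congr_fun hs)

/-- Maps from `A^*` that kill the socle factor through the counit of the coinduced module. -/
theorem IsRadicalExtension.exists_lift_of_dualModule {k : Type u} [Field k] [Algebra k A]
    [Algebra k B] [IsScalarTower k A B] (h : IsRadicalExtension A B)
    (g : DualModule k A →ₗ[A] X) (hg : ∀ φ ∈ dualSocle k A, g φ = 0) :
    ∃ g' : DualModule k A →ₗ[A] Coind A B X, Coind.counit A B X ∘ₗ g' = g := by
  let _ : Module A (DualModule k B) := Module.compHom _ (RingHom.smulOneHom : A →+* B)
  have hA (a : A) (φ : DualModule k B) : a • φ = (a • (1 : B)) • φ := rfl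
  have : IsScalarTower A B (DualModule k B) := ⟨fun a b φ => by
    rw [hA, ← mul_smul, smul_one_mul]⟩
  let f : A →ₗ[k] B := (LinearMap.toSpanSingleton A B 1).restrictScalars k
  have hf (a : A) : f a = a • (1 : B) := rfl
  let res : DualModule k B →ₗ[A] DualModule k A :=
    { toFun := fun φ => LinearMap.comp (M₃ := k) (σ₁₃ := RingHom.id k) φ f
      map_add' := fun _ _ => rfl
      map_smul' := fun a φ => DualModule.ext fun x => by
        change DualModule.eval k B (x • (1 : B) * a • (1 : B)) φ =
          DualModule.eval k B ((x * a) • (1 : B)) φ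
        rw [smul_one_mul, mul_smul] }
  have hres (φ : DualModule k B) (a : A) :
      DualModule.eval k A a (res φ) = DualModule.eval k B (a • (1 : B)) φ := rfl
  have hsurj : Function.Surjective res := fun φ => by
    obtain ⟨l, hl⟩ := f.exists_leftInverse_of_injective (LinearMap.ker_eq_bot'.2 h.eq_zero)
    refine ⟨LinearMap.comp (M₃ := k) (σ₁₃ := RingHom.id k) φ l, DualModule.ext fun x => ?_⟩
    exact congrArg (show A →ₗ[k] k from φ) (LinearMap.congr_fun hl x)
  -- The lift of g ∘ res descends along the surjection B^* → A^*: if φ vanishes on A, then bφ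
  -- vanishes on J_A for each b, because J_A b ⊆ J_B = J_A. So res(bφ) is in the socle, which g
  -- kills.
  have hker : LinearMap.ker res ≤ LinearMap.ker (Coind.lift (B := B) (g ∘ₗ res)) := fun φ hφ => by
    rw [LinearMap.mem_ker]
    ext b
    refine hg _ fun a ha => ?_
    rw [hres, DualModule.eval_smul]
    obtain ⟨a', -, ha'⟩ := h.exists_smul_one (a • (1 : B) * b)
      (Ideal.IsTwoSided.mul_mem_of_left b (h.smul_one_mem a ha))
    rw [← ha', ← hres, LinearMap.mem_ker.1 hφ, map_zero]
  refine ⟨(LinearMap.ker res).liftQ _ hker ∘ₗ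
    (res.quotKerEquivOfSurjective hsurj).symm.toLinearMap, ?_⟩
  ext φ
  obtain ⟨ψ, rfl⟩ := hsurj φ
  have : (res.quotKerEquivOfSurjective hsurj).symm (res ψ) = Submodule.Quotient.mk ψ := by
    rw [LinearEquiv.symm_apply_eq]
    rfl
  rw [LinearMap.comp_apply, LinearMap.comp_apply, LinearEquiv.coe_coe, this]
  exact LinearMap.congr_fun (Coind.counit_comp_lift (B := B) (g ∘ₗ res)) ψ

end RadicalExtension

theorem isNoetherianRing_endRing (k A Z : Type u) [Field k] [Ring A] [Algebra k A]
    [FiniteDimensional k A] [AddCommGroup Z] [Module A Z] [Module.Finite A Z] :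
    IsNoetherianRing (EndRing A Z) := by
  let _ : Module k Z := Module.compHom Z (algebraMap k A)
  have hZ (c : k) (z : Z) : c • z = algebraMap k A c • z := rfl
  have : IsScalarTower k A Z := ⟨fun c a z => by rw [hZ, ← mul_smul, Algebra.smul_def]⟩
  have : Module.Finite k Z := Module.Finite.trans A Z
  let i : Module.End A Z →ₗ[k] (Z →ₗ[k] Z) :=
    { toFun := fun g => g.restrictScalars k
      map_add' := fun _ _ => rfl
      map_smul' := fun _ _ => rfl }
  have : Module.Finite k (Module.End A Z) := Module.Finite.of_injective i fun g g' h =>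
    LinearMap.ext fun z => LinearMap.congr_fun (f := i g) h z
  have : Module.Finite k (EndRing A Z) := Module.Finite.equiv (MulOpposite.opLinearEquiv k)
  exact isNoetherian_of_tower k inferInstance

/-! ### Construction of the approximation -/

section Approximation

variable {k A B N X : Type u} [Field k] [Ring A] [Algebra k A] [Ring B] [Algebra k B]
  [FiniteDimensional k A] [FiniteDimensional k B] [Module A B] [IsScalarTower k A B]
  [IsScalarTower A B B] [AddCommGroup N] [Module A N] [AddCommGroup X] [Module A X]

theorem ContainsRestrictions.hasApproximation_of_dualSocle [Module.Finite A X]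
    (hN : ContainsRestrictions A B N) (h : IsRadicalExtension A B)
    (hNc : ∀ g : N →ₗ[A] X, ∃ g' : N →ₗ[A] Coind A B X, Coind.counit A B X ∘ₗ g' = g)
    (hX : ∀ (g : DualModule k A →ₗ[A] X), ∀ φ ∈ dualSocle k A, g φ = 0) :
    HasApproximation A X (A × DualModule k A × N) := by
  have : IsArtinianRing A := IsArtinianRing.of_finite k A
  have : IsArtinianRing B := IsArtinianRing.of_finite k B
  have : Module.Finite A B := Module.Finite.of_restrictScalars_finite k A B
  have := Coind.finite A B X k
  have : Module.Finite A (Coind A B X) := Module.Finite.trans B _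
  set ε := Coind.counit A B X
  have hAZ : InAdd A A (A × DualModule k A × N) :=
    (InAdd.refl A _).of_retract (LinearMap.inl A _ _) (LinearMap.fst A _ _) fun _ => rfl
  have hNZ : InAdd A N (A × DualModule k A × N) :=
    (InAdd.refl A _).of_retract (LinearMap.inr A A _ ∘ₗ LinearMap.inr A _ _)
      (LinearMap.snd A _ _ ∘ₗ LinearMap.snd A A _) fun _ => rfl
  have hCoind : InAdd A (Coind A B X) N := hN _ inferInstance
  have hJ : InAdd A (Ring.jacobson A) N := hN.inAdd_jacobson h
  -- For x in X, the map J_A → X, r ↦ rx factors through ε because J_A is in add(N).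
  have hT : ∀ r ∈ Ring.jacobson A, ∀ t : X ⧸ LinearMap.range ε, r • t = 0 := fun r hr t => by
    obtain ⟨x, rfl⟩ := Submodule.Quotient.mk_surjective _ t
    rw [← Submodule.Quotient.mk_smul, Submodule.Quotient.mk_eq_zero]
    obtain ⟨g, hg⟩ := hJ.exists_lift ε hNc
      (LinearMap.toSpanSingleton A X x ∘ₗ (Ring.jacobson A).subtype)
    exact ⟨g ⟨r, hr⟩, LinearMap.congr_fun hg ⟨r, hr⟩⟩
  obtain ⟨n, P, q, hP, hq, hqker⟩ := exists_projective_cover hT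
  obtain ⟨q', hq'⟩ := Module.projective_lifting_property (LinearMap.range ε).mkQ q
    (Submodule.mkQ_surjective _)
  have hq' (x : P) : Submodule.Quotient.mk (q' x) = q x := LinearMap.congr_fun hq' x
  have hPA : InAdd A P A := .of_projective
  have hJP : InAdd A (LinearMap.ker q) N := by
    rw [hqker]
    exact (inAdd_jacobson_smul_top hPA).trans hJ
  -- The radical annihilates ker ε: if h(1) = 0, then (rh)(b) = h(br), and br lies in J_B, so br = a
  -- • 1 and the value is a • h(1) = 0.
  have hε : InAdd A (LinearMap.ker ε) N := by
    refine hN.inAdd_of_jacobson_smul_eq_zero h fun r hr x => Subtype.ext (Coind.ext fun b => ?_)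
    change (r • (x : Coind A B X)) b = 0
    obtain ⟨a, -, ha⟩ := h.exists_smul_one (b * r • (1 : B))
      (Ideal.mul_mem_left _ b (h.smul_one_mem r hr))
    have hx : (x : Coind A B X) 1 = 0 := x.2
    rw [Coind.restrict_smul, Coind.smul_apply, ← ha, Coind.map_smul, hx, smul_zero]
  -- The lift l splits the projection of ker p onto ker q = J_A P by y ↦ (y, -l y). This gives ker p
  -- ≅ ker ε ⊕ ker q through (y, c) ↦ (c + l y, y).
  obtain ⟨l, hl⟩ := hJP.exists_lift ε hNc (q' ∘ₗ (LinearMap.ker q).subtype)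
  have hl (x : LinearMap.ker q) : ε (l x) = q' x := LinearMap.congr_fun hl x
  let p : P × Coind A B X →ₗ[A] X := q'.coprod ε
  have hp : Function.Surjective p := fun x => by
    obtain ⟨y, hy⟩ := hq (Submodule.Quotient.mk x)
    rw [← hq', eq_comm, Submodule.Quotient.eq] at hy
    obtain ⟨c, hc⟩ := hy
    exact ⟨(y, c), by simp [p, hc]⟩
  have hpker (x : LinearMap.ker p) : (x : P × Coind A B X).1 ∈ LinearMap.ker q := by
    have hx : q' (x : P × Coind A B X).1 + ε (x : P × Coind A B X).2 = 0 := x.2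
    rw [LinearMap.mem_ker, ← hq', Submodule.Quotient.mk_eq_zero, eq_neg_of_add_eq_zero_left hx]
    exact neg_mem (LinearMap.mem_range_self _ _)
  refine ⟨ModuleCat.of A (P × Coind A B X), p, (hPA.trans hAZ).prod (hCoind.trans hNZ), ?_,
    fun g => ?_⟩
  · let π : LinearMap.ker p →ₗ[A] LinearMap.ker q :=
      LinearMap.codRestrict _ (LinearMap.fst A _ _ ∘ₗ (LinearMap.ker p).subtype) hpker
    refine ((hε.prod hJP).trans hNZ).of_retract
      ((LinearMap.codRestrict _ (LinearMap.snd A _ _ ∘ₗ (LinearMap.ker p).subtype + l ∘ₗ π)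
        fun x => ?_).prod π)
      (LinearMap.codRestrict _ ((Submodule.subtype _ ∘ₗ LinearMap.snd A _ _).prod
        (Submodule.subtype _ ∘ₗ LinearMap.fst A _ _ - l ∘ₗ LinearMap.snd A _ _)) fun x => ?_)
      fun x => Subtype.ext (Prod.ext rfl ?_)
    · have hx : q' (x : P × Coind A B X).1 + ε (x : P × Coind A B X).2 = 0 := x.2
      rw [LinearMap.mem_ker, LinearMap.add_apply, map_add, LinearMap.comp_apply,
        LinearMap.comp_apply, hl, add_comm]
      exact hx
    · have hx : ε x.1 = 0 := x.1.2
      change q' x.2 + ε (x.1 - l x.2) = 0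
      rw [map_sub, hl, hx]
      abel
    · exact add_sub_cancel_right _ _
  -- On A the lift exists because p is surjective; on A^* and N it exists already through ε.
  · obtain ⟨g₁, hg₁⟩ := Module.projective_lifting_property p (g ∘ₗ LinearMap.inl A _ _) hp
    obtain ⟨g₂, hg₂⟩ := h.exists_lift_of_dualModule
      (g ∘ₗ LinearMap.inr A A _ ∘ₗ LinearMap.inl A _ _) (hX _)
    obtain ⟨g₃, hg₃⟩ := hNc (g ∘ₗ LinearMap.inr A A _ ∘ₗ LinearMap.inr A (DualModule k A) _)
    refine ⟨g₁.coprod ((LinearMap.inr A P _ ∘ₗ g₂).coprod (LinearMap.inr A P _ ∘ₗ g₃)), ?_⟩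
    have hpr : p ∘ₗ LinearMap.inr A P _ = ε := LinearMap.coprod_inr _ _
    rw [LinearMap.comp_coprod, LinearMap.comp_coprod, ← LinearMap.comp_assoc,
      ← LinearMap.comp_assoc, hpr, hg₁, hg₂, hg₃]
    refine LinearMap.prod_ext ?_ (LinearMap.prod_ext ?_ ?_) <;> ext <;> simp

theorem ContainsRestrictions.gldim_le_three [Module.Finite A N] [Module B N] [IsScalarTower A B N]
    (hN : ContainsRestrictions A B N) (h : IsRadicalExtension A B) :
    gldim (EndRing A (A × DualModule k A × N)) ≤ 3 := by
  have : IsArtinianRing A := IsArtinianRing.of_finite k A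
  have := finite_dualModule k A
  have : IsNoetherianRing (EndRing A (A × DualModule k A × N)) :=
    isNoetherianRing_endRing k A _
  refine gldim_endRing_le_three fun X _ _ _ => HasApproximation.of_forall_summand fun W hW => ?_
  refine hN.hasApproximation_of_dualSocle h
    (fun g => ⟨Coind.lift g, Coind.counit_comp_lift g⟩) (k := k) fun g φ hφ => ?_
  by_contra h0
  obtain ⟨P, Q, hPQ, hP0, hP⟩ := exists_summand_of_dualModule g hφ h0
  refine hP0 (hW P Q hPQ (hP.trans ?_))
  exact (InAdd.refl A _).of_retract (LinearMap.inr A A _ ∘ₗ LinearMap.inl A _ _)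
    (LinearMap.fst A _ _ ∘ₗ LinearMap.snd A A _) fun _ => rfl

end Approximation

/-! ### Decomposition into indecomposables -/

section KrullSchmidt

variable {R X Z : Type u} [Ring R] [AddCommGroup X] [Module R X] [AddCommGroup Z] [Module R Z]

/-- Modules of finite length are direct sums of indecomposable ones. -/
theorem InAdd.of_forall_indecomposable [IsArtinian R X]
    (h : ∀ W : Submodule R X, IsIndecomposable R W → InAdd R W Z) : InAdd R X Z := by
  refine InAdd.of_equiv ?_ (Submodule.topEquiv (R := R) (M := X)).symm
  induction (⊤ : Submodule R X) using WellFoundedLT.induction with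
  | _ W ih =>
    by_cases hW : IsIndecomposable R W
    · exact h W hW
    · cases subsingleton_or_nontrivial W
      · exact InAdd.of_subsingleton
      · have hlt (P Q : Submodule R W) (hPQ : IsCompl P Q) (hQ : Q ≠ ⊥) : InAdd R P Z := by
          refine (ih (P.map W.subtype) ?_).of_equiv
            (Submodule.equivMapOfInjective W.subtype W.injective_subtype P)
          refine lt_of_le_of_ne (Submodule.map_subtype_le _ _) fun hP => hQ ?_
          have : P = ⊤ := Submodule.map_injective_of_injective W.injective_subtype
            (hP.trans (Submodule.map_subtype_top W).symm)
          subst this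
          exact top_disjoint.1 hPQ.disjoint
        simp only [IsIndecomposable, not_and, not_forall, not_or] at hW
        obtain ⟨P, Q, hPQ, hP, hQ⟩ := hW ‹_›
        exact ((hlt P Q hPQ hQ).prod (hlt Q P hPQ.symm hP)).of_equiv
          (Submodule.prodEquivOfIsCompl P Q hPQ).symm

theorem IsCompleteSystem.inAdd [IsArtinianRing R] [Module.Finite R X] {n : ℕ}
    {M : Fin n → ModuleCat.{u} R} (hM : IsCompleteSystem R M) : InAdd R X (∀ i, M i) := by
  refine InAdd.of_forall_indecomposable fun W hW => ?_
  obtain ⟨i, ⟨e⟩⟩ := hM.exists_iso (ModuleCat.of R W) (inferInstanceAs (Module.Finite R W)) hW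
  exact ((InAdd.refl R (∀ i, M i)).of_retract (LinearMap.single R (fun i => M i) i)
    (LinearMap.proj i) fun x => by simp).of_equiv e

end KrullSchmidt

/-! ### From the algebra homomorphism f to the module setting -/

section Restriction

variable {k A B : Type u} [Field k] [Ring A] [Algebra k A] [Ring B] [Algebra k B]

theorem IsCompleteSystem.isGeneratorCogenerator_and_gldim_le [FiniteDimensional k A]
    [FiniteDimensional k B] (f : A →ₐ[k] B) (hf : IsRadicalEmbedding f) {n : ℕ}
    {M : Fin n → ModuleCat.{u} B} (hM : IsCompleteSystem B M) :
    IsGeneratorCogenerator k A (Witness f M) ∧ gldim (EndRing A (Witness f M)) ≤ 3 := by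
  have : IsArtinianRing B := IsArtinianRing.of_finite k B
  have := finite_dualModule k A
  let _ : Module A B := Module.compHom B (f : A →+* B)
  have hAB (a : A) (b : B) : a • b = f a * b := rfl
  have hone (a : A) : a • (1 : B) = f a := mul_one _
  have : IsScalarTower A B B := ⟨fun a b c => mul_assoc (f a) b c⟩
  have : IsScalarTower k A B := ⟨fun c a b => by rw [hAB, map_smul, smul_mul_assoc, hAB]⟩
  have h : IsRadicalExtension A B :=
    { eq_zero := fun a ha => hf.1 (by rw [← hone, ha, map_zero])
      smul_one_mem := fun a ha => by
        rw [hone]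
        exact hf.2.subset ⟨a, ha, rfl⟩
      exists_smul_one := fun b hb => by
        obtain ⟨a, ha, rfl⟩ := hf.2.superset hb
        exact ⟨a, ha, hone a⟩ }
  have := hM.finite
  let N := restrict f (ModuleCat.of B (∀ i, M i))
  let _ : Module B N := inferInstanceAs (Module B (∀ i, M i))
  have : Module.Finite B N := inferInstanceAs (Module.Finite B (∀ i, M i))
  have : IsScalarTower A B N := ⟨fun a b x => mul_smul (f a) b (show ∀ i, M i from x)⟩
  have : Module.Finite A B := Module.Finite.of_restrictScalars_finite k A B
  have : Module.Finite A N := Module.Finite.trans B N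
  -- A acts on B-modules through f, so a B-linear retraction from a power of N is also A-linear.
  have hN : ContainsRestrictions A B N := fun Y _ _ _ _ _ => by
    obtain ⟨m, i, r, hri⟩ := (hM.inAdd (X := Y)).exists_retract_pi
    have hY (a : A) (y : Y) : a • y = f a • y := by rw [← hone, smul_one_smul]
    exact inAdd_of_retract_pi (Z := N)
      { toFun := i
        map_add' := map_add i
        map_smul' := fun a y => by
          rw [hY, map_smul]
          rfl }
      { toFun := r
        map_add' := map_add r
        map_smul' := fun a y => by
          rw [RingHom.id_apply, hY]
          exact map_smul r (f a) y } hri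
  refine ⟨⟨inferInstanceAs (Module.Finite A (A × DualModule k A × N)), ?_⟩,
    hN.gldim_le_three (k := k) h⟩
  exact (InAdd.refl A (A × DualModule k A × N)).of_retract
    ((LinearMap.fst A _ _).prod ((LinearMap.snd A _ _).prod 0))
    ((LinearMap.fst A _ _).prod (LinearMap.fst A _ _ ∘ₗ LinearMap.snd A _ _)) fun _ => rfl

end Restriction

end RadEmb

theorem theorem1p1 {k A B : Type u} [Field k] [Ring A] [Algebra k A] [Ring B] [Algebra k B]
    [FiniteDimensional k A] [FiniteDimensional k B] (f : A →ₐ[k] B)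
    (hf : RadEmb.IsRadicalEmbedding f) (hB : RadEmb.IsRepresentationFinite B) :
    RadEmb.repdim k A ≤ 3 ∧
      ∀ (n : ℕ) (M : Fin n → ModuleCat.{u} B), RadEmb.IsCompleteSystem B M →
        RadEmb.IsGeneratorCogenerator k A (RadEmb.Witness f M) ∧
          RadEmb.gldim (RadEmb.EndRing A (RadEmb.Witness f M)) ≤ 3 := by
  refine ⟨?_, fun n M hM => hM.isGeneratorCogenerator_and_gldim_le f hf⟩
  obtain ⟨n, M, hM⟩ := hB
  obtain ⟨h, hd⟩ := hM.isGeneratorCogenerator_and_gldim_le f hf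
  exact le_trans (sInf_le ⟨ModuleCat.of A (RadEmb.Witness f M), h, rfl⟩) hd
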